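/- Let $n\ge 0$ be an integer. For a bounded set $\mathscr M$ of real $n\times n$ matrices consider the linear switched system $$(\Sigma_{\mathscr M})\qquad \dot x(t)=A(t)x(t),\quad t\ge 0,\ x(t)\in\mathbb R^n,$$ where the switching law $A$ is an arbitrary measurable function on $[0,\infty)$ with values in $\mathscr M$, and solutions are locally absolutely continuous and satisfy the equation for almost every $t$. Let $\Phi_A(t,0)$ denote the fundamental matrix, so that every solution is $x(t)=\Phi_A(t,0)x(0)$. The system $(\Sigma_{\mathscr M})$ is *uniformly exponentially stable* if there exist $C,\gamma>0$ such that $\|\Phi_A(t,0)\|\le Ce^{-\gamma t}$ for every switching law $A$ and every $t\ge 0$. A *common Lyapunov function* for $(\Sigma_{\mathscr M})$ is a continuous function $V:\mathbb R^n\to[0,\infty)$ with $V(0)=0$ and $V(x)>0$ for $x\ne 0$ such that, for every switching law, $t\mapsto V(x(t))$ is strictly decreasing on $[0,\infty)$ along every nonzero trajectory $x$. A set $\mathcal P$ of functions $\mathbb R^n\to\mathbb R$ is a *universal class of Lyapunov functions* if, for every bounded set $\mathscr M$ of real $n\times n$ matrices such that $(\Sigma_{\mathscr M})$ is uniformly exponentially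 stable, $\mathcal P$ contains a common Lyapunov function for $(\Sigma_{\mathscr M})$. Then both the family of polyhedral functions $$\Big\{x\mapsto \max_{k=1,\dots,N}|l_k^{\top}x| \;\Big|\; N\ge 1,\ l_1,\dots,l_N\in\mathbb R^n\Big\}$$ and the family of homogeneous sums of even powers $$\Big\{x\mapsto \sum_{k=1}^N (l_k^{\top}x)^{2d} \;\Big|\; N\ge 1,\ d\ge 1,\ l_1,\dots,l_N\in\mathbb R^n\Big\}$$ are universal classes of Lyapunov functions. -/

import Mathlib

open scoped Matrix.Norms.L2Operator

namespace SwitchedSystem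

/-- The state space `ℝⁿ` with its Euclidean norm. -/
abbrev State (n : ℕ) := EuclideanSpace ℝ (Fin n)

/-- Switching laws: (entrywise) measurable functions of time whose values on `[0, ∞)` lie in `𝓜`.
The values at negative times never matter. -/
def IsSwitchingLaw {n : ℕ} (𝓜 : Set (Matrix (Fin n) (Fin n) ℝ))
    (A : ℝ → Matrix (Fin n) (Fin n) ℝ) : Prop :=
  (∀ i j, Measurable (fun t => A t i j)) ∧ ∀ t, 0 ≤ t → A t ∈ 𝓜

/-- `x` solves `x' = A(t) x` on `[0, ∞)` in the sense of Carathéodory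
(locally absolutely continuous, equation satisfied almost everywhere), written as an integral
equation. -/
structure IsTrajectory {n : ℕ} (A : ℝ → Matrix (Fin n) (Fin n) ℝ) (x : ℝ → State n) : Prop where
  continuousOn : ContinuousOn x (Set.Ici 0)
  intervalIntegrable : ∀ t, 0 ≤ t → IntervalIntegrable
    (fun s => Matrix.toEuclideanCLM (𝕜 := ℝ) (A s) (x s)) MeasureTheory.volume 0 t
  eq_integral : ∀ t, 0 ≤ t →
    x t = x 0 + ∫ s in (0 : ℝ)..t, Matrix.toEuclideanCLM (𝕜 := ℝ) (A s) (x s)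

/-- `Φ t` is the fundamental matrix from time `0` to time `t ≥ 0`: the solution on `[0, ∞)`, in the
sense of Carathéodory, of `Φ' = A(t) Φ`, `Φ 0 = 1`. -/
structure IsFundamentalMatrix {n : ℕ} (A Φ : ℝ → Matrix (Fin n) (Fin n) ℝ) : Prop where
  continuousOn : ContinuousOn Φ (Set.Ici 0)
  intervalIntegrable : ∀ t, 0 ≤ t → IntervalIntegrable
    (fun s => A s * Φ s) MeasureTheory.volume 0 t
  eq_integral : ∀ t, 0 ≤ t → Φ t = 1 + ∫ s in (0 : ℝ)..t, A s * Φ s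

/-- Uniform exponential stability; the norm is the operator norm induced by the Euclidean norm. -/
def UniformlyExponentiallyStable {n : ℕ} (𝓜 : Set (Matrix (Fin n) (Fin n) ℝ)) : Prop :=
  ∃ C > (0 : ℝ), ∃ γ > (0 : ℝ), ∀ A Φ : ℝ → Matrix (Fin n) (Fin n) ℝ,
    IsSwitchingLaw 𝓜 A → IsFundamentalMatrix A Φ →
      ∀ t, 0 ≤ t → ‖Φ t‖ ≤ C * Real.exp (-γ * t)

/-- Nonstrict common Lyapunov functions: continuous, positive definite, and non-increasing along
all trajectories. -/
structure IsNonstrictCommonLyapunov {n : ℕ} (𝓜 : Set (Matrix (Fin n) (Fin n) ℝ))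
    (V : State n → ℝ) : Prop where
  continuous : Continuous V
  map_zero : V 0 = 0
  pos : ∀ x, x ≠ 0 → 0 < V x
  antitoneOn : ∀ (A : ℝ → Matrix (Fin n) (Fin n) ℝ) (x : ℝ → State n),
    IsSwitchingLaw 𝓜 A → IsTrajectory A x → AntitoneOn (fun t => V (x t)) (Set.Ici 0)

/-- Common Lyapunov functions: moreover strictly decreasing along nonzero trajectories. -/
structure IsCommonLyapunov {n : ℕ} (𝓜 : Set (Matrix (Fin n) (Fin n) ℝ))
    (V : State n → ℝ) : Prop extends IsNonstrictCommonLyapunov 𝓜 V where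
  strictAntiOn : ∀ (A : ℝ → Matrix (Fin n) (Fin n) ℝ) (x : ℝ → State n),
    IsSwitchingLaw 𝓜 A → IsTrajectory A x → (∃ t, 0 ≤ t ∧ x t ≠ 0) →
      StrictAntiOn (fun t => V (x t)) (Set.Ici 0)

/-- `𝓟` contains a common Lyapunov function for every uniformly exponentially stable linear
switched system on `ℝⁿ` given by a bounded set of matrices. -/
def IsUniversal {n : ℕ} (𝓟 : Set (State n → ℝ)) : Prop :=
  ∀ 𝓜 : Set (Matrix (Fin n) (Fin n) ℝ), Bornology.IsBounded 𝓜 →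
    UniformlyExponentiallyStable 𝓜 → ∃ V ∈ 𝓟, IsCommonLyapunov 𝓜 V

/-- Polyhedral functions `x ↦ max_k |l_kᵀ x|`, over finite nonempty families of vectors `l_k`. -/
def polyhedralFunctions (n : ℕ) : Set (State n → ℝ) :=
  {V | ∃ (N : ℕ) (l : Fin (N + 1) → State n),
    V = fun x => Finset.univ.sup' Finset.univ_nonempty (fun k => |inner ℝ (l k) x|)}

/-- Homogeneous sums of even powers `x ↦ ∑_k (l_kᵀ x)^(2d)`, `d ≥ 1`, over finite nonempty families
of vectors `l_k`. -/
def homogeneousSumsOfSquares (n : ℕ) : Set (State n → ℝ) :=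
  {V | ∃ (N d : ℕ) (l : Fin (N + 1) → State n), 1 ≤ d ∧
    V = fun x => ∑ k, (inner ℝ (l k) x) ^ (2 * d)}

end SwitchedSystem

open Set Filter Topology MeasureTheory

/-! ### Decay of a norm along trajectories from contraction of Euler steps -/

namespace SwitchedSystem

/-! Everything rests on one discrete condition: a norm `P`, a step `h > 0` and some `ρ < 1` with `P
(y + h M y) ≤ ρ P y` for all `M ∈ 𝓜` and all `y`.

Such a norm exists (`exists_contracted_seminorm`): `P y` is the supremum of `‖e^{γt} Φ_A(t,0) y‖`
over all laws and times, finite by stability. Prepending a constant phase `M` to a law shows that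
`e^{hM}` contracts `P` by `e^{-γh}`. The Euler step `1 + hM` differs from `e^{hM}` by `o(h)`
uniformly on the bounded set `𝓜`, so it still contracts for small `h`.

The condition implies strict decay along trajectories (`seminorm_le_exp_mul`), with no
differentiability of the norm required. It also survives perturbation: if `α P ≤ Q ≤ β P` and `β ρ <
α`, then `Q` is contracted with constant `β ρ / α < 1` (`isCommonLyapunov_of_comparable`). Hence it
suffices to approximate `P` closely. Finitely many supporting functionals give a polyhedral norm
(`exists_polyhedral_approx`), and the `ℓ^{2d}` norm of the same functionals is close to their
maximum for large `d`; its `2d`-th power is the sum of even powers. -/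

/-- Hahn–Banach: a seminorm has a supporting functional at every point. -/
theorem exists_supporting_functional {E : Type*} [AddCommGroup E] [Module ℝ E]
    (P : Seminorm ℝ E) (x : E) : ∃ f : E →ₗ[ℝ] ℝ, f x = P x ∧ ∀ y, |f y| ≤ P y := by
  by_cases hx : x = 0
  · exact ⟨0, by simp [hx], by simp⟩
  obtain ⟨g, hg, hgP⟩ := exists_extension_of_le_sublinear
    (LinearPMap.mkSpanSingleton (σ := RingHom.id ℝ) x (P x) hx) P
    (fun c hc y => by rw [map_smul_eq_mul, Real.norm_of_nonneg hc.le]) (map_add_le_add P) (by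
      rintro ⟨y, hy⟩
      obtain ⟨c, rfl⟩ := Submodule.mem_span_singleton.mp hy
      erw [LinearPMap.mkSpanSingleton'_apply]
      rw [map_smul_eq_mul, RingHom.id_apply, smul_eq_mul]
      exact mul_le_mul_of_nonneg_right (le_abs_self c) (apply_nonneg P x))
  refine ⟨g, ?_, fun y => abs_le.mpr ⟨?_, hgP y⟩⟩
  · have := hg ⟨x, Submodule.mem_span_singleton_self x⟩
    rw [LinearPMap.mkSpanSingleton_apply] at this
    exact this
  · have := hgP (-y)
    rw [map_neg, map_neg_eq_map] at this
    linarith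

/-- A functional supporting `P` at the integral commutes with integration, which reduces the bound
to a scalar integral. -/
theorem seminorm_integral_le {E : Type*} [NormedAddCommGroup E] [NormedSpace ℝ E]
    [FiniteDimensional ℝ E] (P : Seminorm ℝ E) {w : ℝ → E} {a b c : ℝ} (hab : a ≤ b)
    (hw : IntervalIntegrable w volume a b) (h : ∀ u ∈ Icc a b, P (w u) ≤ c) :
    P (∫ u in a..b, w u) ≤ (b - a) * c := by
  have := FiniteDimensional.complete ℝ E
  obtain ⟨f, hf, hfP⟩ := exists_supporting_functional P (∫ u in a..b, w u)
  have hcomm := f.toContinuousLinearMap.intervalIntegral_comp_comm hw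
  rw [LinearMap.coe_toContinuousLinearMap', hf] at hcomm
  rw [← hcomm]
  calc ∫ u in a..b, f (w u) ≤ ∫ _ in a..b, c :=
        intervalIntegral.integral_mono_on hab
          ⟨f.toContinuousLinearMap.integrable_comp hw.1, f.toContinuousLinearMap.integrable_comp hw.2⟩ intervalIntegrable_const
          fun u hu => (le_abs_self _).trans ((hfP _).trans (h u hu))
    _ = (b - a) * c := by simp

/-- Growth estimate for absolutely continuous curves `x` with velocity `v`, when one explicit Euler
step of length `h` multiplies the seminorm `P` by at most `ρ`. -/
theorem seminorm_le_exp_mul {E : Type*} [NormedAddCommGroup E] [NormedSpace ℝ E]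
    [FiniteDimensional ℝ E] (P : Seminorm ℝ E) (hP : Continuous P) {x v : ℝ → E}
    {a b h ρ : ℝ} (hh : 0 < h) (hx : ContinuousOn x (Icc a b))
    (hv : ∀ s ∈ Icc a b, ∀ t ∈ Icc a b, IntervalIntegrable v volume s t)
    (hxv : ∀ s ∈ Icc a b, ∀ t ∈ Icc a b, x t = x s + ∫ u in s..t, v u)
    (hstep : ∀ u ∈ Icc a b, P (x u + h • v u) ≤ ρ * P (x u)) :
    ∀ t ∈ Icc a b, P (x t) ≤ P (x a) * Real.exp ((ρ - 1) / h * (t - a)) := by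
  intro t ht
  rw [← gronwallBound_ε0]
  -- Grönwall in its Dini-derivative form: `P ∘ x` need not be differentiable.
  refine le_gronwallBound_of_liminf_deriv_right_le (f := fun t => P (x t))
    (f' := fun t => (ρ - 1) / h * P (x t)) (hP.comp_continuousOn hx) ?_ le_rfl
    (fun s _ => (add_zero _).ge) t ht
  intro s hs r hr
  have hsI : s ∈ Icc a b := Ico_subset_Icc_self hs
  set q : ℝ := P (x s) with hq
  obtain ⟨c, hc1, hc2⟩ : ∃ c, ρ * q < c ∧ c < h * r + q := by
    apply exists_between
    have : h * ((ρ - 1) / h * q) < h * r := mul_lt_mul_of_pos_left hr hh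
    have e : h * ((ρ - 1) / h * q) = (ρ - 1) * q := by field_simp
    linarith
  have hxs : Tendsto x (𝓝[Icc a b] s) (𝓝 (x s)) := hx s hsI
  -- This expression bounds `P (x s + h • v u)`. Only `x` has to be continuous; `v` may be merely
  -- integrable.
  have hlim : Tendsto (fun u => ρ * P (x u) + P (x s - x u)) (𝓝[Icc a b] s) (𝓝 (ρ * q)) := by
    have h1 := ((hP.tendsto _).comp hxs).const_mul ρ
    have h2 := (hP.tendsto _).comp (hxs.const_sub (x s))
    simpa using h1.add h2
  have hev : ∀ᶠ u in 𝓝[Icc a b] s, ρ * P (x u) + P (x s - x u) < c := hlim.eventually_lt_const hc1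
  rw [eventually_nhdsWithin_iff, Metric.eventually_nhds_iff] at hev
  obtain ⟨δ, hδ, hball⟩ := hev
  refine Eventually.frequently ?_
  have hδ' : s < min (min (s + δ) (s + h)) b := by
    simp only [lt_min_iff]
    exact ⟨⟨by linarith, by linarith⟩, hs.2⟩
  filter_upwards [Ioo_mem_nhdsGT hδ'] with z hz
  simp only [mem_Ioo, lt_min_iff] at hz
  obtain ⟨hsz, ⟨hzδ, hzh⟩, hzb⟩ := hz
  have hzI : z ∈ Icc a b := ⟨hsI.1.trans hsz.le, hzb.le⟩
  have hint : P (∫ u in s..z, (x s + h • v u)) ≤ (z - s) * c := by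
    refine seminorm_integral_le P hsz.le
      (intervalIntegrable_const.add ((hv s hsI z hzI).smul h)) fun u hu => ?_
    have huI : u ∈ Icc a b := ⟨hsI.1.trans hu.1, hu.2.trans hzI.2⟩
    have hu' := hball (y := u) (by rw [Real.dist_eq, abs_of_nonneg] <;> linarith [hu.1, hu.2]) huI
    calc P (x s + h • v u) = P ((x u + h • v u) + (x s - x u)) := by congr 1; abel
      _ ≤ P (x u + h • v u) + P (x s - x u) := map_add_le_add P _ _
      _ ≤ c := by linarith [hstep u huI]
  rw [intervalIntegral.integral_add (g := fun u => h • v u) intervalIntegrable_const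
    ((hv s hsI z hzI).smul h), intervalIntegral.integral_const, intervalIntegral.integral_smul] at hint
  -- For `z - s ≤ h`, `x z` is a convex combination of `x s` and the mean over `[s, z]` of the Euler
  -- points `x s + h • v u`.
  have hxz : x z = (1 - (z - s) / h) • x s +
      h⁻¹ • ((z - s) • x s + h • ∫ u in s..z, v u) := by
    rw [hxv s hsI z hzI, smul_add, smul_smul, smul_smul, inv_mul_cancel₀ hh.ne', one_smul,
      ← add_assoc, ← add_smul]
    congr 1
    rw [show 1 - (z - s) / h + h⁻¹ * (z - s) = 1 by ring, one_smul]
  have hle : (z - s) / h ≤ 1 := by rw [div_le_one hh]; linarith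
  have hPz : P (x z) ≤ (1 - (z - s) / h) * q + h⁻¹ * ((z - s) * c) := by
    rw [hxz]
    refine (map_add_le_add P _ _).trans ?_
    rw [map_smul_eq_mul, map_smul_eq_mul, Real.norm_of_nonneg (by linarith),
      Real.norm_of_nonneg (by positivity)]
    gcongr
  rw [inv_mul_lt_iff₀ (by linarith)]
  calc P (x z) - q ≤ (z - s) * ((c - q) / h) := by
        have : (z - s) * ((c - q) / h) = (1 - (z - s) / h) * q + h⁻¹ * ((z - s) * c) - q := by
          field_simp; ring
        linarith
    _ < (z - s) * r := by
        refine mul_lt_mul_of_pos_left ?_ (by linarith)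
        rw [div_lt_iff₀ hh]; linarith

variable {n : ℕ} {𝓜 : Set (Matrix (Fin n) (Fin n) ℝ)} {A : ℝ → Matrix (Fin n) (Fin n) ℝ}
  {x : ℝ → State n}

theorem IsTrajectory.intervalIntegrable' (hx : IsTrajectory A x) {s t : ℝ} (hs : 0 ≤ s)
    (ht : 0 ≤ t) :
    IntervalIntegrable (fun s => Matrix.toEuclideanCLM (𝕜 := ℝ) (A s) (x s)) volume s t :=
  (hx.intervalIntegrable s hs).symm.trans (hx.intervalIntegrable t ht)

theorem IsTrajectory.eq_add_integral (hx : IsTrajectory A x) {s t : ℝ} (hs : 0 ≤ s)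
    (ht : 0 ≤ t) :
    x t = x s + ∫ u in s..t, Matrix.toEuclideanCLM (𝕜 := ℝ) (A u) (x u) := by
  rw [hx.eq_integral t ht, hx.eq_integral s hs, add_assoc,
    intervalIntegral.integral_add_adjacent_intervals (hx.intervalIntegrable s hs)
      (hx.intervalIntegrable' hs ht)]

/-- Growth of a seminorm along trajectories. -/
theorem IsTrajectory.seminorm_le (hx : IsTrajectory A x) (hA : IsSwitchingLaw 𝓜 A)
    (P : Seminorm ℝ (State n)) (hP : Continuous P) {h ρ : ℝ} (hh : 0 < h)
    (hstep : ∀ M ∈ 𝓜, ∀ y, P (y + h • Matrix.toEuclideanCLM (𝕜 := ℝ) M y) ≤ ρ * P y)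
    {s t : ℝ} (hs : 0 ≤ s) (hst : s ≤ t) :
    P (x t) ≤ P (x s) * Real.exp ((ρ - 1) / h * (t - s)) := by
  refine seminorm_le_exp_mul (b := t) P hP hh
    (hx.continuousOn.mono fun u hu => hs.trans hu.1)
    (fun u hu w hw => hx.intervalIntegrable' (hs.trans hu.1) (hs.trans hw.1))
    (fun u hu w hw => hx.eq_add_integral (hs.trans hu.1) (hs.trans hw.1))
    (fun u hu => hstep _ (hA.2 u (hs.trans hu.1)) _) t ⟨hst, le_rfl⟩

/-- Backward uniqueness: a trajectory that vanishes at some time vanished before. -/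
theorem IsTrajectory.eq_zero_of_le (hx : IsTrajectory A x) (hA : IsSwitchingLaw 𝓜 A) {K : ℝ}
    (hK : ∀ M ∈ 𝓜, ‖M‖ ≤ K) {s t : ℝ} (hs : 0 ≤ s) (hst : s ≤ t) (ht : x t = 0) : x s = 0 := by
  have hK0 : 0 ≤ K := (norm_nonneg _).trans (hK _ (hA.2 s hs))
  have hmaps : ∀ u ∈ Icc 0 (t - s), 0 ≤ t - u := fun u hu => by linarith [hu.2]
  -- The growth estimate for the time-reversed curve, which starts from `x t = 0`; its unit Euler
  -- step grows by at most `1 + K`.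
  have key := seminorm_le_exp_mul (a := 0) (b := t - s) (h := 1) (ρ := 1 + K)
    (x := fun u => x (t - u))
    (v := fun u => -Matrix.toEuclideanCLM (𝕜 := ℝ) (A (t - u)) (x (t - u)))
    (normSeminorm ℝ (State n)) continuous_norm one_pos
    (hx.continuousOn.comp (by fun_prop) hmaps) ?_ ?_ ?_ (t - s) ⟨by linarith, le_rfl⟩
  · simpa [ht] using key
  · intro u hu w hw
    have := (hx.intervalIntegrable' (hmaps u hu) (hmaps w hw)).comp_sub_left t
    simpa using! this.neg
  · intro u hu w hw
    rw [intervalIntegral.integral_neg, intervalIntegral.integral_comp_sub_left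
      (fun u => Matrix.toEuclideanCLM (𝕜 := ℝ) (A u) (x u)),
      ← intervalIntegral.integral_symm]
    exact hx.eq_add_integral (hmaps u hu) (hmaps w hw)
  · intro u hu
    simp only [coe_normSeminorm, one_smul]
    refine (norm_add_le _ _).trans ?_
    rw [norm_neg, add_mul, one_mul]
    gcongr
    refine (ContinuousLinearMap.le_opNorm _ _).trans ?_
    gcongr
    exact hK _ (hA.2 _ (hmaps u hu))

/-- A norm contracted by the Euler steps of all matrices of the system is, up to a strictly
increasing change of values, a common Lyapunov function. -/
theorem isCommonLyapunov_of_seminorm (hM : Bornology.IsBounded 𝓜) (P : Seminorm ℝ (State n))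
    (hP : Continuous P) (hpos : ∀ y, y ≠ 0 → 0 < P y) {h ρ : ℝ} (hh : 0 < h)
    (hρ1 : ρ < 1)
    (hstep : ∀ M ∈ 𝓜, ∀ y, P (y + h • Matrix.toEuclideanCLM (𝕜 := ℝ) M y) ≤ ρ * P y)
    {φ : ℝ → ℝ} (hφ : StrictMonoOn φ (Ici 0)) (hφ0 : φ 0 = 0) {V : State n → ℝ}
    (hV : Continuous V) (hVφ : ∀ y, V y = φ (P y)) : IsCommonLyapunov 𝓜 V where
  continuous := hV
  map_zero := by rw [hVφ, map_zero, hφ0]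
  pos y hy := by
    rw [hVφ, ← hφ0]
    exact hφ self_mem_Ici (hpos y hy).le (hpos y hy)
  antitoneOn A x hA hx := by
    intro s hs t ht hst
    simp only [hVφ]
    refine hφ.monotoneOn (apply_nonneg P _) (apply_nonneg P _)
      ((hx.seminorm_le hA P hP hh hstep hs hst).trans
        (mul_le_of_le_one_right (apply_nonneg P _) (Real.exp_le_one_iff.mpr ?_)))
    exact mul_nonpos_of_nonpos_of_nonneg
      (div_nonpos_of_nonpos_of_nonneg (by linarith) hh.le) (by linarith)
  strictAntiOn A x hA hx := by
    rintro ⟨r, hr, hxr⟩ s hs t ht hst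
    obtain ⟨K, hK⟩ := hM.exists_norm_le
    have hxs : x s ≠ 0 := by
      intro h0
      rcases le_total s r with hsr | hsr
      · have := hx.seminorm_le hA P hP hh hstep hs hsr
        rw [h0, map_zero, zero_mul] at this
        exact (hpos _ hxr).not_ge this
      · exact hxr (hx.eq_zero_of_le hA hK hr hsr h0)
    simp only [hVφ]
    refine hφ (apply_nonneg P _) (apply_nonneg P _)
      ((hx.seminorm_le hA P hP hh hstep hs hst.le).trans_lt
        (mul_lt_of_lt_one_right (hpos _ hxs) (Real.exp_lt_one_iff.mpr ?_)))
    exact mul_neg_of_neg_of_pos (div_neg_of_neg_of_pos (by linarith) hh) (by linarith)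

end SwitchedSystem

/-! ### Approximation by polyhedral norms and by even-power norms -/

namespace SwitchedSystem

/-- Approximation of a norm by a polyhedral norm. -/
theorem exists_polyhedral_approx {E : Type*} [NormedAddCommGroup E] [InnerProductSpace ℝ E]
    [FiniteDimensional ℝ E] (P : Seminorm ℝ E) (hP : Continuous P) (hpos : ∀ y, y ≠ 0 → 0 < P y)
    {θ : ℝ} (hθ : θ < 1) :
    ∃ (N : ℕ) (l : Fin (N + 1) → E), (∀ k y, |inner ℝ (l k) y| ≤ P y) ∧
      ∀ y, ∃ k, θ * P y ≤ |inner ℝ (l k) y| := by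
  have := FiniteDimensional.complete ℝ E
  have hsupp : ∀ x : E, ∃ l : E, inner ℝ l x = P x ∧ ∀ y, |inner ℝ l y| ≤ P y := by
    intro x
    obtain ⟨f, hf, hfP⟩ := exists_supporting_functional P x
    have hr : ∀ y, inner ℝ ((InnerProductSpace.toDual ℝ E).symm f.toContinuousLinearMap) y = f y :=
      fun y => by simp
    exact ⟨_, by rw [hr, hf], fun y => by rw [hr]; exact hfP y⟩
  choose l hl hlP using hsupp
  obtain ⟨t, -, ht⟩ := (isCompact_sphere (0 : E) 1).elim_nhds_subcover
    (fun x => {y | θ * P y < |inner ℝ (l x) y|}) (fun x hx => by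
      refine (isOpen_lt (by fun_prop) (by fun_prop)).mem_nhds ?_
      have hx0 : 0 < P x := hpos x (ne_zero_of_mem_unit_sphere ⟨x, hx⟩)
      rw [mem_ofPred_eq, hl, abs_of_pos hx0]
      exact mul_lt_of_lt_one_left hx0 hθ)
  classical
  -- Adjoining the index `0` makes the family nonempty even when the sphere is empty; `l 0` is also
  -- bounded by `P`, so nothing is lost.
  obtain ⟨N, hN⟩ : ∃ N, (insert 0 t).card = N + 1 :=
    Nat.exists_eq_succ_of_ne_zero (Finset.card_ne_zero_of_mem (Finset.mem_insert_self 0 t))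
  let e := (insert 0 t).equivFinOfCardEq hN
  refine ⟨N, fun k => l (e.symm k), fun k y => hlP _ _, fun y => ?_⟩
  by_cases hy : y = 0
  · exact ⟨0, by simp [hy]⟩
  have hy' : 0 < ‖y‖ := norm_pos_iff.mpr hy
  have hmem := ht (show ‖y‖⁻¹ • y ∈ Metric.sphere (0 : E) 1 by
    simp [norm_smul, hy'.ne'])
  simp only [mem_iUnion, mem_ofPred_eq] at hmem
  obtain ⟨x, hx, hxy⟩ := hmem
  refine ⟨e ⟨x, Finset.mem_insert_of_mem hx⟩, ?_⟩
  rw [map_smul_eq_mul, inner_smul_right, abs_mul, norm_inv, norm_norm, abs_inv, abs_norm,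
    mul_left_comm] at hxy
  simpa using (lt_of_mul_lt_mul_left hxy (by positivity)).le

variable {n : ℕ} {𝓜 : Set (Matrix (Fin n) (Fin n) ℝ)}

/-- The seminorm `x ↦ max_k |l_kᵀ x|`. -/
noncomputable def polyhedralSeminorm {N : ℕ} (l : Fin (N + 1) → State n) :
    Seminorm ℝ (State n) :=
  (normSeminorm ℝ (Fin (N + 1) → ℝ)).comp (LinearMap.pi fun k => (innerₗ (State n) (l k)))

/-- The seminorm `x ↦ (∑_k |l_kᵀ x|^p)^(1/p)`. -/
noncomputable def powerSeminorm {N : ℕ} (p : ENNReal) [Fact (1 ≤ p)] (l : Fin (N + 1) → State n) :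
    Seminorm ℝ (State n) :=
  (normSeminorm ℝ (PiLp p fun _ : Fin (N + 1) => ℝ)).comp
    ((WithLp.linearEquiv p ℝ (Fin (N + 1) → ℝ)).symm.toLinearMap ∘ₗ
      LinearMap.pi fun k => (innerₗ (State n) (l k)))

theorem polyhedralSeminorm_apply {N : ℕ} (l : Fin (N + 1) → State n) (x : State n) :
    polyhedralSeminorm l x = ‖fun k => inner ℝ (l k) x‖ := rfl

theorem polyhedralSeminorm_eq_sup' {N : ℕ} (l : Fin (N + 1) → State n) (x : State n) :
    polyhedralSeminorm l x =
      Finset.univ.sup' Finset.univ_nonempty (fun k => |inner ℝ (l k) x|) := by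
  rw [polyhedralSeminorm_apply]
  refine le_antisymm ((pi_norm_le_iff_of_nonempty _).mpr fun k => ?_)
    (Finset.sup'_le _ _ fun k _ => norm_le_pi_norm (fun k => inner ℝ (l k) x) k)
  exact Finset.le_sup' (fun k => |inner ℝ (l k) x|) (Finset.mem_univ k)

theorem powerSeminorm_apply {N d : ℕ} [Fact (1 ≤ ((2 * d : ℕ) : ENNReal))] (hd : 1 ≤ d)
    (l : Fin (N + 1) → State n) (x : State n) :
    powerSeminorm ((2 * d : ℕ) : ENNReal) l x =
      (∑ k, inner ℝ (l k) x ^ (2 * d)) ^ (1 / ((2 * d : ℕ) : ℝ)) := by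
  have h0 : 0 < ((2 * d : ℕ) : ENNReal).toReal := by
    rw [ENNReal.toReal_natCast]; positivity
  change ‖WithLp.toLp ((2 * d : ℕ) : ENNReal) (fun k => inner ℝ (l k) x)‖ = _
  rw [PiLp.norm_eq_sum h0, ENNReal.toReal_natCast]
  congr 1
  refine Finset.sum_congr rfl fun k _ => ?_
  rw [Real.rpow_natCast, Real.norm_eq_abs, (even_two_mul d).pow_abs]

theorem sum_pow_nonneg {N d : ℕ} (l : Fin (N + 1) → State n) (x : State n) :
    0 ≤ ∑ k, inner ℝ (l k) x ^ (2 * d) :=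
  Finset.sum_nonneg fun _ _ => (even_two_mul d).pow_nonneg _

theorem powerSeminorm_pow {N d : ℕ} [Fact (1 ≤ ((2 * d : ℕ) : ENNReal))] (hd : 1 ≤ d)
    (l : Fin (N + 1) → State n) (x : State n) :
    powerSeminorm ((2 * d : ℕ) : ENNReal) l x ^ (2 * d) = ∑ k, inner ℝ (l k) x ^ (2 * d) := by
  rw [powerSeminorm_apply hd, one_div, Real.rpow_inv_natCast_pow (sum_pow_nonneg l x) (by omega)]

theorem abs_inner_le_powerSeminorm {N d : ℕ} [Fact (1 ≤ ((2 * d : ℕ) : ENNReal))] (hd : 1 ≤ d)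
    (l : Fin (N + 1) → State n) (x : State n) (k : Fin (N + 1)) :
    |inner ℝ (l k) x| ≤ powerSeminorm ((2 * d : ℕ) : ENNReal) l x := by
  refine le_of_pow_le_pow_left₀ (n := 2 * d) (by omega) (apply_nonneg _ _) ?_
  rw [powerSeminorm_pow hd, (even_two_mul d).pow_abs]
  exact Finset.single_le_sum (f := fun k => inner ℝ (l k) x ^ (2 * d))
    (fun _ _ => (even_two_mul d).pow_nonneg _) (Finset.mem_univ k)

theorem powerSeminorm_le {N d : ℕ} [Fact (1 ≤ ((2 * d : ℕ) : ENNReal))] (hd : 1 ≤ d)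
    (l : Fin (N + 1) → State n) (x : State n) {c : ℝ} (hc : ∀ k, |inner ℝ (l k) x| ≤ c) :
    powerSeminorm ((2 * d : ℕ) : ENNReal) l x ≤ ((N + 1 : ℕ) : ℝ) ^ (1 / ((2 * d : ℕ) : ℝ)) * c := by
  have hc0 : 0 ≤ c := (abs_nonneg _).trans (hc 0)
  refine le_of_pow_le_pow_left₀ (n := 2 * d) (by omega) (by positivity) ?_
  rw [powerSeminorm_pow hd, mul_pow, one_div,
    Real.rpow_inv_natCast_pow (Nat.cast_nonneg _) (by omega)]
  calc ∑ k, inner ℝ (l k) x ^ (2 * d) ≤ ∑ _k : Fin (N + 1), c ^ (2 * d) :=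
        Finset.sum_le_sum fun k _ => by
          rw [← (even_two_mul d).pow_abs]
          exact pow_le_pow_left₀ (abs_nonneg _) (hc k) _
    _ = _ := by simp

/-- Passing from a contracted norm `P` to a seminorm `Q` between `α P` and `β P`. -/
theorem isCommonLyapunov_of_comparable (hM : Bornology.IsBounded 𝓜) (P Q : Seminorm ℝ (State n))
    (hP : Continuous P) (hpos : ∀ y, y ≠ 0 → 0 < P y) {h ρ α β : ℝ} (hh : 0 < h) (hρ : 0 ≤ ρ)
    (hstep : ∀ M ∈ 𝓜, ∀ y, P (y + h • Matrix.toEuclideanCLM (𝕜 := ℝ) M y) ≤ ρ * P y)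
    (hα : 0 < α) (hβ : 0 ≤ β) (hαβ : β * ρ < α) (hle : ∀ y, α * P y ≤ Q y)
    (hge : ∀ y, Q y ≤ β * P y) {φ : ℝ → ℝ} (hφ : StrictMonoOn φ (Ici 0)) (hφ0 : φ 0 = 0)
    {V : State n → ℝ} (hV : Continuous V) (hVφ : ∀ y, V y = φ (Q y)) :
    IsCommonLyapunov 𝓜 V := by
  have hQ : Continuous Q := by
    refine Seminorm.continuous_of_le (q := β.toNNReal • P) ?_ fun y => by
      change Q y ≤ (β.toNNReal : ℝ) * P y
      rw [Real.coe_toNNReal β hβ]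
      exact hge y
    change Continuous fun y => (β.toNNReal : ℝ) * P y
    fun_prop
  refine isCommonLyapunov_of_seminorm hM Q hQ
    (fun y hy => (mul_pos hα (hpos y hy)).trans_le (hle y)) hh (ρ := β * ρ / α)
    (by rwa [div_lt_one hα]) (fun M hMM y => (hge _).trans ?_) hφ hφ0 hV hVφ
  calc β * P _ ≤ β * (ρ * P y) := by gcongr; exact hstep M hMM y
    _ = β * ρ / α * (α * P y) := by field_simp
    _ ≤ _ := by gcongr; exact hle y

/-- Any accuracy `θ` with `ρ < θ < 1` suffices, since the polyhedral norm lies between `θ P` and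
`P`. -/
theorem exists_polyhedral_isCommonLyapunov (hM : Bornology.IsBounded 𝓜) (P : Seminorm ℝ (State n))
    (hP : Continuous P) (hpos : ∀ y, y ≠ 0 → 0 < P y) {h ρ : ℝ} (hh : 0 < h) (hρ : 0 ≤ ρ)
    (hρ1 : ρ < 1)
    (hstep : ∀ M ∈ 𝓜, ∀ y, P (y + h • Matrix.toEuclideanCLM (𝕜 := ℝ) M y) ≤ ρ * P y) :
    ∃ V ∈ polyhedralFunctions n, IsCommonLyapunov 𝓜 V := by
  obtain ⟨θ, hθ, hθ1⟩ := exists_between hρ1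
  obtain ⟨N, l, hlP, hPl⟩ := exists_polyhedral_approx P hP hpos hθ1
  refine ⟨_, ⟨N, l, rfl⟩, isCommonLyapunov_of_comparable hM P (polyhedralSeminorm l) hP hpos hh hρ
    hstep (α := θ) (β := 1) (by linarith) zero_le_one (by linarith) (fun y => ?_) (fun y => ?_)
    (φ := id) (strictMono_id.strictMonoOn _) rfl ?_ fun y => (polyhedralSeminorm_eq_sup' l y).symm⟩
  · obtain ⟨k, hk⟩ := hPl y
    rw [polyhedralSeminorm_apply]
    exact hk.trans (norm_le_pi_norm (fun k => inner ℝ (l k) y) k)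
  · rw [one_mul, polyhedralSeminorm_apply]
    exact (pi_norm_le_iff_of_nonempty _).mpr fun k => hlP k y
  · simp_rw [← polyhedralSeminorm_eq_sup', polyhedralSeminorm_apply]
    fun_prop

/-- The number of functionals is fixed by `θ` before `d` is chosen. Replacing the maximum by the
`ℓ^{2d}` norm costs a factor at most `(N + 1)^{1/(2d)}`, which tends to `1` and so fits in the gap
between `ρ` and `θ`. -/
theorem exists_sumOfPowers_isCommonLyapunov (hM : Bornology.IsBounded 𝓜)
    (P : Seminorm ℝ (State n)) (hP : Continuous P) (hpos : ∀ y, y ≠ 0 → 0 < P y) {h ρ : ℝ}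
    (hh : 0 < h) (hρ : 0 ≤ ρ) (hρ1 : ρ < 1)
    (hstep : ∀ M ∈ 𝓜, ∀ y, P (y + h • Matrix.toEuclideanCLM (𝕜 := ℝ) M y) ≤ ρ * P y) :
    ∃ V ∈ homogeneousSumsOfSquares n, IsCommonLyapunov 𝓜 V := by
  obtain ⟨θ, hθ, hθ1⟩ := exists_between hρ1
  obtain ⟨N, l, hlP, hPl⟩ := exists_polyhedral_approx P hP hpos hθ1
  obtain ⟨d, hdθ, hd⟩ : ∃ d : ℕ, ((N + 1 : ℕ) : ℝ) ^ (1 / ((2 * d : ℕ) : ℝ)) * ρ < θ ∧ 1 ≤ d := by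
    have h1 : Tendsto (fun d : ℕ => 1 / ((2 * d : ℕ) : ℝ)) atTop (𝓝 0) :=
      tendsto_one_div_atTop_nhds_zero_nat.comp
        (tendsto_id.const_mul_atTop' (two_pos : 0 < 2))
    have h2 := ((Real.continuous_const_rpow (a := ((N + 1 : ℕ) : ℝ)) (by positivity)).tendsto
      0).comp h1
    have h3 := h2.mul_const ρ
    rw [Real.rpow_zero, one_mul] at h3
    exact ((h3.eventually_lt_const hθ).and (eventually_ge_atTop 1)).exists
  have : Fact (1 ≤ ((2 * d : ℕ) : ENNReal)) := ⟨by exact_mod_cast (by omega : 1 ≤ 2 * d)⟩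
  refine ⟨_, ⟨N, d, l, hd, rfl⟩, isCommonLyapunov_of_comparable hM P
    (powerSeminorm ((2 * d : ℕ) : ENNReal) l) hP hpos hh hρ
    hstep (α := θ) (by linarith) (by positivity) hdθ (fun y => ?_)
    (fun y => powerSeminorm_le hd l y fun k => hlP k y)
    (φ := fun r => r ^ (2 * d)) (pow_left_strictMonoOn₀ (by omega)) (zero_pow (by omega))
    (by fun_prop) fun y => (powerSeminorm_pow hd l y).symm⟩
  obtain ⟨k, hk⟩ := hPl y
  exact hk.trans (abs_inner_le_powerSeminorm hd l y k)

end SwitchedSystem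

/-! ### Concatenation of switching laws and the contracted norm -/

namespace SwitchedSystem

variable {n : ℕ} {𝓜 : Set (Matrix (Fin n) (Fin n) ℝ)}

theorem continuous_exp_smul (M : Matrix (Fin n) (Fin n) ℝ) :
    Continuous fun u : ℝ => NormedSpace.exp (u • M) :=
  continuous_iff_continuousAt.mpr fun u => (hasDerivAt_exp_smul_const (𝕂 := ℝ) M u).continuousAt

theorem intervalIntegrable_mul_exp (M : Matrix (Fin n) (Fin n) ℝ) (a b : ℝ) :
    IntervalIntegrable (fun u : ℝ => M * NormedSpace.exp (u • M)) volume a b :=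
  (continuous_const.mul (continuous_exp_smul M)).intervalIntegrable a b

theorem integral_mul_exp (M : Matrix (Fin n) (Fin n) ℝ) (t : ℝ) :
    ∫ u in (0 : ℝ)..t, M * NormedSpace.exp (u • M) = NormedSpace.exp (t • M) - 1 := by
  rw [intervalIntegral.integral_eq_sub_of_hasDerivAt
    (fun u _ => hasDerivAt_exp_smul_const' (𝕂 := ℝ) M u) (intervalIntegrable_mul_exp M 0 t)]
  simp

/-- The fundamental matrix of a constant switching law. -/
theorem isFundamentalMatrix_const (M : Matrix (Fin n) (Fin n) ℝ) :
    IsFundamentalMatrix (fun _ => M) (fun t => NormedSpace.exp (t • M)) where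
  continuousOn := (continuous_exp_smul M).continuousOn
  intervalIntegrable t _ := intervalIntegrable_mul_exp M 0 t
  eq_integral t _ := by rw [integral_mul_exp]; abel

/-- The constant law `M` on `[0, s]`, followed by the law `A`. -/
noncomputable def prependLaw (M : Matrix (Fin n) (Fin n) ℝ) (s : ℝ)
    (A : ℝ → Matrix (Fin n) (Fin n) ℝ) (t : ℝ) : Matrix (Fin n) (Fin n) ℝ :=
  if t ≤ s then M else A (t - s)

theorem IsSwitchingLaw.prepend {A : ℝ → Matrix (Fin n) (Fin n) ℝ} (hA : IsSwitchingLaw 𝓜 A)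
    {M : Matrix (Fin n) (Fin n) ℝ} (hM : M ∈ 𝓜) (s : ℝ) :
    IsSwitchingLaw 𝓜 (prependLaw M s A) := by
  refine ⟨fun i j => ?_, fun t _ => ?_⟩
  · have : (fun t => prependLaw M s A t i j) = fun t => if t ≤ s then M i j else A (t - s) i j := by
      ext t
      unfold prependLaw
      split_ifs <;> rfl
    rw [this]
    exact Measurable.ite measurableSet_Iic measurable_const
      ((hA.1 i j).comp (measurable_id.sub_const s))
  · unfold prependLaw
    split_ifs with h
    · exact hM
    · exact hA.2 _ (by linarith)

/-- The truncations `max` and `min` merge both phases into one formula: before time `s` the left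
factor is `Φ 0 = 1`, afterwards the right factor is frozen at `exp (s • M)`. -/
theorem IsFundamentalMatrix.prepend {A Φ : ℝ → Matrix (Fin n) (Fin n) ℝ}
    (hΦ : IsFundamentalMatrix A Φ) (M : Matrix (Fin n) (Fin n) ℝ) {s : ℝ} (hs : 0 ≤ s) :
    IsFundamentalMatrix (prependLaw M s A)
      (fun t => Φ (max (t - s) 0) * NormedSpace.exp (min t s • M)) := by
  have hΦ0 : Φ 0 = 1 := by simpa using hΦ.eq_integral 0 le_rfl
  set X := NormedSpace.exp (s • M) with hX
  have hfst : ∀ t ≤ s, EqOn (fun u : ℝ => M * NormedSpace.exp (u • M))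
      (fun u => prependLaw M s A u * (Φ (max (u - s) 0) * NormedSpace.exp (min u s • M)))
      (Iic t) := by
    intro t ht u hu
    have hus : u ≤ s := le_trans hu ht
    simp only [prependLaw, if_pos hus, min_eq_left hus, max_eq_right (sub_nonpos.mpr hus), hΦ0,
      one_mul]
  have hsnd : EqOn (fun u : ℝ => A (u - s) * Φ (u - s) * X)
      (fun u => prependLaw M s A u * (Φ (max (u - s) 0) * NormedSpace.exp (min u s • M)))
      (Ioi s) := by
    intro u hu
    have hus : s < u := hu
    simp only [prependLaw, if_neg hus.not_ge, min_eq_right hus.le,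
      max_eq_left (sub_nonneg.mpr hus.le), mul_assoc, hX]
  have hint1 : ∀ t, 0 ≤ t → t ≤ s → IntervalIntegrable
      (fun u => prependLaw M s A u * (Φ (max (u - s) 0) * NormedSpace.exp (min u s • M)))
      volume 0 t := fun t h0 hts =>
    (intervalIntegrable_mul_exp M 0 t).congr ((hfst t hts).mono
      (by rw [uIoc_of_le h0]; exact fun u hu => hu.2))
  have hint2' : ∀ t, s ≤ t → IntervalIntegrable (fun u => A (u - s) * Φ (u - s) * X)
      volume s t := by
    intro t hst
    have := ((hΦ.intervalIntegrable (t - s) (by linarith)).comp_sub_right s)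
    rw [zero_add, sub_add_cancel] at this
    exact this.mul_const X
  have hint2 : ∀ t, s ≤ t → IntervalIntegrable
      (fun u => prependLaw M s A u * (Φ (max (u - s) 0) * NormedSpace.exp (min u s • M)))
      volume s t := fun t hst =>
    (hint2' t hst).congr (hsnd.mono (by rw [uIoc_of_le hst]; exact fun u hu => hu.1))
  have heq1 : ∀ t, 0 ≤ t → t ≤ s → ∫ u in (0 : ℝ)..t,
      prependLaw M s A u * (Φ (max (u - s) 0) * NormedSpace.exp (min u s • M)) =
        NormedSpace.exp (t • M) - 1 := by
    intro t h0 hts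
    rw [← integral_mul_exp]
    exact (intervalIntegral.integral_congr ((hfst t hts).mono
      (by rw [uIcc_of_le h0]; exact fun u hu => hu.2))).symm
  refine ⟨?_, fun t ht => ?_, fun t ht => ?_⟩
  · refine ContinuousOn.mul (hΦ.continuousOn.comp (by fun_prop) fun t _ => mem_Ici.mpr (le_max_right _ _)) ?_
    exact ((continuous_exp_smul M).comp (continuous_id.min continuous_const)).continuousOn
  · rcases le_total t s with hts | hst
    · exact hint1 t ht hts
    · exact (hint1 s hs le_rfl).trans (hint2 t hst)
  · rcases le_total t s with hts | hst
    · rw [heq1 t ht hts, min_eq_left hts, max_eq_right (sub_nonpos.mpr hts), hΦ0, one_mul]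
      abel
    · have heq2 : ∫ u in s..t,
          prependLaw M s A u * (Φ (max (u - s) 0) * NormedSpace.exp (min u s • M)) =
            (Φ (t - s) - 1) * X := by
        calc _ = ∫ u in s..t, A (u - s) * Φ (u - s) * X :=
              (intervalIntegral.integral_congr_ae (Eventually.of_forall fun u hu => by
                rw [uIoc_of_le hst] at hu
                exact hsnd hu.1)).symm
          _ = ∫ u in (0 : ℝ)..(t - s), A u * Φ u * X := by
              rw [intervalIntegral.integral_comp_sub_right (fun u => A u * Φ u * X), sub_self]
          _ = (∫ u in (0 : ℝ)..(t - s), A u * Φ u) * X :=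
              ((ContinuousLinearMap.mul ℝ (Matrix (Fin n) (Fin n) ℝ)).flip X
                ).intervalIntegral_comp_comm (hΦ.intervalIntegrable _ (by linarith))
          _ = _ := by rw [hΦ.eq_integral (t - s) (by linarith), add_sub_cancel_left]
      rw [← intervalIntegral.integral_add_adjacent_intervals (hint1 s hs le_rfl) (hint2 t hst),
        heq1 s hs le_rfl, heq2, min_eq_right hst, max_eq_left (sub_nonneg.mpr hst), ← hX, sub_mul,
        one_mul]
      abel

/-- The exponentially weighted fundamental matrices of the system. -/
def weightedFundamentalMatrices (𝓜 : Set (Matrix (Fin n) (Fin n) ℝ)) (γ : ℝ) :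
    Set (Matrix (Fin n) (Fin n) ℝ) :=
  {B | ∃ A Φ t, IsSwitchingLaw 𝓜 A ∧ IsFundamentalMatrix A Φ ∧ 0 ≤ t ∧ B = Real.exp (γ * t) • Φ t}

theorem one_mem_weightedFundamentalMatrices (h : 𝓜.Nonempty) (γ : ℝ) :
    1 ∈ weightedFundamentalMatrices 𝓜 γ := by
  obtain ⟨M, hM⟩ := h
  exact ⟨fun _ => M, _, 0, ⟨fun _ _ => measurable_const, fun _ _ => hM⟩, isFundamentalMatrix_const M, le_rfl,
    by simp⟩

/-- Prepending multiplies on the right, next to the vector, so a supremum over this set contracts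
under `y ↦ exp (s • M) y`. -/
theorem smul_mul_exp_mem_weightedFundamentalMatrices {γ : ℝ} {B M : Matrix (Fin n) (Fin n) ℝ}
    (hB : B ∈ weightedFundamentalMatrices 𝓜 γ) (hM : M ∈ 𝓜) {s : ℝ} (hs : 0 ≤ s) :
    Real.exp (γ * s) • (B * NormedSpace.exp (s • M)) ∈ weightedFundamentalMatrices 𝓜 γ := by
  obtain ⟨A, Φ, t, hA, hΦ, ht, rfl⟩ := hB
  refine ⟨_, _, t + s, hA.prepend hM s, hΦ.prepend M hs, by linarith, ?_⟩
  rw [add_sub_cancel_right, max_eq_left ht, min_eq_right (by linarith), smul_mul_assoc, smul_smul,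
    ← Real.exp_add]
  congr 2
  ring

theorem exists_contracted_seminorm (hM : Bornology.IsBounded 𝓜) (hne : 𝓜.Nonempty)
    (hS : UniformlyExponentiallyStable 𝓜) :
    ∃ P : Seminorm ℝ (State n), Continuous P ∧ (∀ y, y ≠ 0 → 0 < P y) ∧ ∃ h ρ : ℝ, 0 < h ∧ 0 ≤ ρ ∧
      ρ < 1 ∧ ∀ M ∈ 𝓜, ∀ y, P (y + h • Matrix.toEuclideanCLM (𝕜 := ℝ) M y) ≤ ρ * P y := by
  obtain ⟨C, hC, γ, hγ, hS⟩ := hS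
  obtain ⟨K, hK0, hK⟩ := hM.exists_pos_norm_le
  have hBC : ∀ B ∈ weightedFundamentalMatrices 𝓜 γ, ‖B‖ ≤ C := by
    rintro _ ⟨A, Φ, t, hA, hΦ, ht, rfl⟩
    rw [norm_smul, Real.norm_of_nonneg (Real.exp_pos _).le]
    calc Real.exp (γ * t) * ‖Φ t‖ ≤ Real.exp (γ * t) * (C * Real.exp (-γ * t)) := by
          gcongr
          exact hS A Φ hA hΦ t ht
      _ = C * Real.exp (γ * t + -γ * t) := by rw [Real.exp_add]; ring
      _ = C := by simp
  have hle : ∀ (B : Matrix (Fin n) (Fin n) ℝ) (y : State n),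
      ‖Matrix.toEuclideanCLM (𝕜 := ℝ) B y‖ ≤ ‖B‖ * ‖y‖ :=
    fun B y => (Matrix.toEuclideanCLM (𝕜 := ℝ) B).le_opNorm y
  let p : weightedFundamentalMatrices 𝓜 γ → Seminorm ℝ (State n) := fun B =>
    (normSeminorm ℝ (State n)).comp (Matrix.toEuclideanCLM (𝕜 := ℝ) B.1).toLinearMap
  have hpapply : ∀ B y, p B y = ‖Matrix.toEuclideanCLM (𝕜 := ℝ) B.1 y‖ := fun _ _ => rfl
  have hpC : ∀ B y, p B y ≤ C * ‖y‖ := fun B y => by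
    rw [hpapply]
    exact (hle _ _).trans (by gcongr; exact hBC _ B.2)
  have hbdd : BddAbove (range p) :=
    Seminorm.bddAbove_range_iff.mpr fun y => ⟨C * ‖y‖, by rintro _ ⟨B, rfl⟩; exact hpC B y⟩
  have hone := one_mem_weightedFundamentalMatrices hne γ
  have : Nonempty (weightedFundamentalMatrices 𝓜 γ) := ⟨⟨1, hone⟩⟩
  set P : Seminorm ℝ (State n) := ⨆ B, p B with hPdef
  have hpP : ∀ B y, p B y ≤ P y := fun B y => le_ciSup hbdd B y
  have hPle : ∀ y c, (∀ B, p B y ≤ c) → P y ≤ c := fun y c h => by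
    rw [hPdef, Seminorm.iSup_apply hbdd]
    exact ciSup_le h
  have hnormP : ∀ y, ‖y‖ ≤ P y := fun y => by
    simpa [hpapply] using hpP ⟨1, hone⟩ y
  have hPcont : Continuous P := by
    refine Seminorm.continuous_of_le (q := C.toNNReal • normSeminorm ℝ (State n)) ?_ fun y => ?_
    · change Continuous fun y : State n => (C.toNNReal : ℝ) * ‖y‖
      fun_prop
    · change P y ≤ (C.toNNReal : ℝ) * ‖y‖
      rw [Real.coe_toNNReal C hC.le]
      exact hPle y _ fun B => hpC B y
  have hexp := (hasFDerivAt_exp_zero (𝕂 := ℝ) (𝔸 := Matrix (Fin n) (Fin n) ℝ)).isLittleO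
  -- With this tolerance the remainder of the Euler step, multiplied by `‖B‖ ≤ C`, costs at most `γ
  -- h / 4`, half of the decay `γ h / 2` available from `exp (-(γ h))`.
  have hε : 0 < γ / (4 * C * K) := by positivity
  obtain ⟨δ, hδ, hball⟩ := Metric.eventually_nhds_iff.mp (hexp.def hε)
  -- The first bound puts `h • M` in the `δ`-ball for every `M ∈ 𝓜`; the second gives `γ h < 1/2`,
  -- so the quadratic error of `exp (-(γ h))` is below `γ h / 2`.
  obtain ⟨h, hh, hhlt⟩ : ∃ h, 0 < h ∧ h < min (δ / K) (1 / (2 * γ)) :=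
    exists_between (by positivity)
  obtain ⟨hhδ, hhγ⟩ := lt_min_iff.mp hhlt
  rw [lt_div_iff₀ hK0] at hhδ
  rw [lt_div_iff₀ (by positivity)] at hhγ
  have hexpγ : Real.exp (-(γ * h)) ≤ 1 - γ * h / 2 := by
    have hpos : 0 < γ * h := by positivity
    have := Real.abs_exp_sub_one_sub_id_le (x := -(γ * h)) (by rw [abs_neg, abs_of_pos hpos]; linarith)
    have := (abs_le.mp this).2
    nlinarith
  refine ⟨P, hPcont, fun y hy => (norm_pos_iff.mpr hy).trans_le (hnormP y), h, 1 - γ * h / 4, hh,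
    by linarith, by linarith [mul_pos hγ hh], fun M hMM y => hPle _ _ fun B => ?_⟩
  set R : Matrix (Fin n) (Fin n) ℝ := NormedSpace.exp (h • M) - 1 - h • M with hR
  have hRnorm : ‖R‖ ≤ γ / (4 * C * K) * (h * K) := by
    have hM' : ‖h • M‖ ≤ h * K := by
      rw [norm_smul, Real.norm_of_nonneg hh.le]
      gcongr
      exact hK M hMM
    have := hball (y := h • M) (by rw [dist_zero_right]; linarith)
    simp only [sub_zero, NormedSpace.exp_zero] at this
    exact this.trans (by gcongr)
  set D : Matrix (Fin n) (Fin n) ℝ := Real.exp (γ * h) • (B.1 * NormedSpace.exp (h • M)) with hD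
  have hDmem : D ∈ weightedFundamentalMatrices 𝓜 γ :=
    smul_mul_exp_mem_weightedFundamentalMatrices B.2 hMM hh.le
  have hdecomp : B.1 * (1 + h • M) = Real.exp (-(γ * h)) • D - B.1 * R := by
    rw [hD, smul_smul, ← Real.exp_add, neg_add_cancel, Real.exp_zero, one_smul, ← mul_sub, hR]
    congr 1
    abel
  have hy : Matrix.toEuclideanCLM (𝕜 := ℝ) B.1 (y + h • Matrix.toEuclideanCLM (𝕜 := ℝ) M y) =
      Real.exp (-(γ * h)) • Matrix.toEuclideanCLM (𝕜 := ℝ) D y -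
        Matrix.toEuclideanCLM (𝕜 := ℝ) (B.1 * R) y := by
    have := congrArg (fun Z => Matrix.toEuclideanCLM (𝕜 := ℝ) Z y) hdecomp
    simp only [map_mul, map_add, map_sub, map_one, map_smul] at this
    rw [map_mul]
    exact this
  rw [hpapply, hy]
  calc ‖_‖ ≤ Real.exp (-(γ * h)) * ‖Matrix.toEuclideanCLM (𝕜 := ℝ) D y‖ +
        ‖Matrix.toEuclideanCLM (𝕜 := ℝ) (B.1 * R) y‖ := by
        refine (norm_sub_le _ _).trans_eq ?_
        rw [norm_smul, Real.norm_of_nonneg (Real.exp_pos _).le]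
    _ ≤ (1 - γ * h / 2) * P y + (C * (γ / (4 * C * K) * (h * K))) * P y := by
        gcongr
        · linarith
        · exact hpP ⟨D, hDmem⟩ y
        · refine (hle _ _).trans (mul_le_mul ?_ (hnormP y) (norm_nonneg _) (by positivity))
          refine (norm_mul_le _ _).trans ?_
          gcongr
          exact hBC _ B.2
    _ = (1 - γ * h / 4) * P y := by field_simp; ring

end SwitchedSystem

theorem mainTheorem2 (n : ℕ) :
    SwitchedSystem.IsUniversal (SwitchedSystem.polyhedralFunctions n) ∧
      SwitchedSystem.IsUniversal (SwitchedSystem.homogeneousSumsOfSquares n) := by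
  have key : ∀ 𝓜 : Set (Matrix (Fin n) (Fin n) ℝ), Bornology.IsBounded 𝓜 →
      SwitchedSystem.UniformlyExponentiallyStable 𝓜 →
      ∃ P : Seminorm ℝ (SwitchedSystem.State n), Continuous P ∧ (∀ y, y ≠ 0 → 0 < P y) ∧
        ∃ h ρ : ℝ, 0 < h ∧ 0 ≤ ρ ∧ ρ < 1 ∧
          ∀ M ∈ 𝓜, ∀ y, P (y + h • Matrix.toEuclideanCLM (𝕜 := ℝ) M y) ≤ ρ * P y := by
    intro 𝓜 hM hS
    rcases 𝓜.eq_empty_or_nonempty with rfl | hne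
    -- Without matrices there are no switching laws, so the supremum would be over an empty set; any
    -- norm works, as the contraction condition is vacuous.
    · exact ⟨normSeminorm ℝ _, continuous_norm, fun y hy => norm_pos_iff.mpr hy, 1, 0, one_pos,
        le_rfl, one_pos, by simp⟩
    · exact SwitchedSystem.exists_contracted_seminorm hM hne hS
  constructor
  · intro 𝓜 hM hS
    obtain ⟨P, hP, hpos, h, ρ, hh, hρ, hρ1, hstep⟩ := key 𝓜 hM hS
    exact SwitchedSystem.exists_polyhedral_isCommonLyapunov hM P hP hpos hh hρ hρ1 hstep
  · intro 𝓜 hM hS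
    obtain ⟨P, hP, hpos, h, ρ, hh, hρ, hρ1, hstep⟩ := key 𝓜 hM hS
    exact SwitchedSystem.exists_sumOfPowers_isCommonLyapunov hM P hP hpos hh hρ hρ1 hstep
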